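/- Let $m\ge 1$ be an integer and let $f$ be a real- or complex-valued integrable function on $[-1,1]$ whose $m$-th derivative $\frac{d^m f}{dt^m}$ is integrable on $[-1,1]$; that is, there is an integrable function $g=\frac{d^mf}{dt^m}$ on $[-1,1]$ with $$\int_{-1}^{1} f(t)\,\varphi^{(m)}(t)\,dt=(-1)^m\int_{-1}^{1} g(t)\,\varphi(t)\,dt$$ for every infinitely differentiable real-valued function $\varphi$ with compact support in $(-1,1)$ (equivalently, after changing $f$ on a null set, $f$ is $m-1$ times continuously differentiable on $[-1,1]$ and $f^{(m-1)}$ is absolutely continuous there). Let $P_n$ be the $n$-th Legendre polynomial, $P_n(t)=\frac{1}{2^n n!}\frac{d^n}{dt^n}(t^2-1)^n$, and let $$c_n=\frac{2n+1}{2}\int_{-1}^{1} f(t)P_n(t)\,dt$$ be the Legendre coefficients of $f$. Then there is a constant $C$, not depending on $n$, such that $$|c_n|\le \frac{C}{n^{m-\frac12}}\qquad\text{for all } n\ge 1.$$ -/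

import Mathlib

open scoped ContDiff

/-- The Legendre polynomial `P_n`, by Rodrigues' formula
`P_n = 1 / (2 ^ n * n!) * (d/dx) ^ n (x ^ 2 - 1) ^ n`. -/
noncomputable def legendrePoly (n : ℕ) : Polynomial ℝ :=
  Polynomial.C (1 / (2 ^ n * (n.factorial : ℝ))) *
    (Polynomial.derivative^[n] ((Polynomial.X ^ 2 - 1) ^ n))

/-- The `n`-th Legendre coefficient `c_n = (2 n + 1) / 2 * ∫_{-1}^1 f(t) P_n(t) dt` of a real or
complex valued function on `[-1, 1]`. -/
noncomputable def legendreCoeff {𝕜 : Type*} [RCLike 𝕜] (f : ℝ → 𝕜) (n : ℕ) : 𝕜 :=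
  ((2 * (n : ℝ) + 1) / 2) • ∫ t in (-1 : ℝ)..1, (legendrePoly n).eval t • f t

/-- `g` is the `m`-th derivative of `f` on `(-1, 1)` in the weak (distributional) sense:
`∫ φ^(m) f = (-1) ^ m ∫ φ g` for every smooth `φ` with compact support in `(-1, 1)`.
Used for `f` and `g` integrable on `[-1, 1]`. -/
def IsWeakIteratedDeriv {𝕜 : Type*} [RCLike 𝕜] (m : ℕ) (f g : ℝ → 𝕜) : Prop :=
  ∀ φ : ℝ → ℝ, ContDiff ℝ ∞ φ → HasCompactSupport φ → tsupport φ ⊆ Set.Ioo (-1 : ℝ) 1 →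
    ∫ t in (-1 : ℝ)..1, iteratedDeriv m φ t • f t =
      (-1 : ℝ) ^ m • ∫ t in (-1 : ℝ)..1, φ t • g t

/-! Write `P_n = D^n b_n` with `b_n = rodriguesBase n`. For `n = j + m` the polynomial `D^j b_n` is
an `m`-th primitive of `P_n` and is divisible by `(X^2 - 1)^m`, so integrating by parts `m` times
turns `∫ f P_n` into `± ∫ g D^j b_n` (`IsWeakIteratedDeriv.integral_iterate_derivative_smul`). It
remains to bound `D^j b_n` on `[-1, 1]` by `O(n^(-m-1/2))`; the factor `(2n+1)/2` then costs one
power of `n`.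

For `m = 1` a Sonin function, maximal at `0`, gives the bound (`legendrePrimitive_sq_le`). Each
further primitive gains a factor `1/n` through `iterate_derivative_rodriguesBase_recurrence`. -/

open Polynomial in
/-- The polynomial `(X ^ 2 - 1) ^ n / (2 ^ n * n!)` whose `n`-th derivative is `legendrePoly n`. -/
noncomputable def rodriguesBase (n : ℕ) : ℝ[X] :=
  C (1 / (2 ^ n * (n.factorial : ℝ))) * (X ^ 2 - 1) ^ n

/-! ### Primitives of Legendre polynomials: identities and uniform bounds. -/

section Polynomials

open Polynomial

theorem legendrePoly_eq_iterate_derivative (n : ℕ) :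
    legendrePoly n = derivative^[n] (rodriguesBase n) := by
  rw [rodriguesBase, iterate_derivative_C_mul, legendrePoly]

theorem derivative_rodriguesBase_succ (n : ℕ) :
    derivative (rodriguesBase (n + 1)) = X * rodriguesBase n := by
  have h : C (1 / (2 ^ (n + 1) * ((n + 1).factorial : ℝ))) * (2 * (C ((n : ℝ) + 1))) =
      C (1 / (2 ^ n * (n.factorial : ℝ))) := by
    rw [← C_ofNat, ← C_mul, ← C_mul]
    congr 1
    rw [Nat.factorial_succ]
    push_cast
    field_simp
    ring
  rw [rodriguesBase, rodriguesBase, ← h, derivative_C_mul, derivative_pow]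
  simp
  ring

theorem sq_sub_one_mul_rodriguesBase (n : ℕ) :
    (X ^ 2 - 1) * rodriguesBase n = C (2 * ((n : ℝ) + 1)) * rodriguesBase (n + 1) := by
  have h : C (2 * ((n : ℝ) + 1)) * C (1 / (2 ^ (n + 1) * ((n + 1).factorial : ℝ))) =
      C (1 / (2 ^ n * (n.factorial : ℝ))) := by
    rw [← C_mul]
    congr 1
    rw [Nat.factorial_succ]
    push_cast
    field_simp
    ring
  rw [rodriguesBase, rodriguesBase, ← h]
  ring

theorem derivative_derivative_rodriguesBase (n : ℕ) :
    derivative (derivative (rodriguesBase (n + 2))) =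
      C (2 * (n : ℝ) + 3) * rodriguesBase (n + 1) + rodriguesBase n := by
  have h := sq_sub_one_mul_rodriguesBase n
  rw [derivative_rodriguesBase_succ, derivative_mul, derivative_rodriguesBase_succ, derivative_X]
  simp only [C_add, C_mul, C_1, C_ofNat] at h ⊢
  linear_combination h

theorem sq_sub_one_mul_derivative_rodriguesBase (n : ℕ) :
    (X ^ 2 - 1) * derivative (rodriguesBase n) = C (2 * (n : ℝ)) * X * rodriguesBase n := by
  cases n with
  | zero => simp [rodriguesBase]
  | succ n =>
    have h := sq_sub_one_mul_rodriguesBase n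
    rw [derivative_rodriguesBase_succ]
    push_cast
    linear_combination X * h

/-- This is `sq_sub_one_mul_derivative_rodriguesBase` differentiated `k + 1` times. -/
theorem iterate_derivative_rodriguesBase_ode (n k : ℕ) :
    (X ^ 2 - 1) * derivative^[k + 2] (rodriguesBase n) +
        C (2 * ((k : ℝ) + 1)) * X * derivative^[k + 1] (rodriguesBase n) +
        C ((k : ℝ) * (k + 1)) * derivative^[k] (rodriguesBase n) =
      C (2 * (n : ℝ)) * X * derivative^[k + 1] (rodriguesBase n) +
        C (2 * (n : ℝ) * (k + 1)) * derivative^[k] (rodriguesBase n) := by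
  induction k with
  | zero =>
    have h := congrArg derivative (sq_sub_one_mul_derivative_rodriguesBase n)
    simp [Function.iterate_succ_apply', C_ofNat] at h ⊢
    linear_combination h
  | succ k ih =>
    have h := congrArg derivative ih
    simp [Function.iterate_succ_apply', C_ofNat] at h ⊢
    linear_combination h

theorem iterate_derivative_succ_X_mul (p : ℝ[X]) (k : ℕ) :
    derivative^[k + 1] (X * p) =
      X * derivative^[k + 1] p + C ((k : ℝ) + 1) * derivative^[k] p := by
  induction k with
  | zero => simp; ring
  | succ k ih =>
    rw [Function.iterate_succ_apply', ih]
    simp [Function.iterate_succ_apply']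
    ring

/-- Legendre's equation integrated once: at `k = n` the first-order terms of the ODE for
`rodriguesBase (n + 1)` cancel. -/
theorem sq_sub_one_mul_derivative_legendrePoly (n : ℕ) :
    (X ^ 2 - 1) * derivative (legendrePoly (n + 1)) =
      C (((n : ℝ) + 1) * (n + 2)) * derivative^[n] (rodriguesBase (n + 1)) := by
  have h := iterate_derivative_rodriguesBase_ode (n + 1) n
  rw [legendrePoly_eq_iterate_derivative, ← Function.iterate_succ_apply' derivative]
  simp [C_ofNat] at h ⊢
  linear_combination h

theorem derivative_legendrePoly_succ (n : ℕ) :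
    derivative (legendrePoly (n + 1)) =
      X * derivative (legendrePoly n) + C ((n : ℝ) + 1) * legendrePoly n := by
  rw [legendrePoly_eq_iterate_derivative, legendrePoly_eq_iterate_derivative,
    ← Function.iterate_succ_apply' derivative, ← Function.iterate_succ_apply' derivative,
    Function.iterate_succ_apply, derivative_rodriguesBase_succ, iterate_derivative_succ_X_mul]

/-- At `j = n + 1` this is the classical `(2n+3) P_{n+1} = P'_{n+2} - P'_n`; smaller `j` give its
integrated forms. -/
theorem iterate_derivative_rodriguesBase_recurrence (j n : ℕ) :
    C (2 * (n : ℝ) + 3) * derivative^[j] (rodriguesBase (n + 1)) =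
      derivative^[j + 2] (rodriguesBase (n + 2)) - derivative^[j] (rodriguesBase n) := by
  have h := congrArg derivative^[j] (derivative_derivative_rodriguesBase n)
  rw [iterate_map_add, iterate_derivative_C_mul, ← Function.iterate_succ_apply,
    ← Function.iterate_succ_apply] at h
  rw [h]
  ring

theorem legendrePrimitive_eval_zero (n : ℕ) :
    ((n : ℝ) + 2) * (derivative^[n] (rodriguesBase (n + 1))).eval 0 =
      -(legendrePoly n).eval 0 := by
  have h1 := congrArg (eval 0) (sq_sub_one_mul_derivative_legendrePoly n)
  rw [derivative_legendrePoly_succ] at h1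
  simp at h1
  have : (n : ℝ) + 1 ≠ 0 := by positivity
  apply mul_left_cancel₀ this
  linear_combination -h1

theorem legendrePoly_eval_zero_recurrence (n : ℕ) :
    ((n : ℝ) + 2) * (legendrePoly (n + 2)).eval 0 = -((n : ℝ) + 1) * (legendrePoly n).eval 0 := by
  have h1 := congrArg (eval 0) (iterate_derivative_rodriguesBase_recurrence n n)
  rw [← legendrePoly_eq_iterate_derivative, ← legendrePoly_eq_iterate_derivative] at h1
  have h2 := legendrePrimitive_eval_zero n
  simp at h1
  linear_combination (-((n : ℝ) + 2)) * h1 + (2 * (n : ℝ) + 3) * h2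

/-- The two-step recurrence preserves the bound because `(n+1)(n+3) ≤ (n+2)^2`; no Stirling estimate
is needed. -/
theorem legendrePoly_eval_zero_sq_le (n : ℕ) :
    (legendrePoly n).eval 0 ^ 2 * ((n : ℝ) + 1) ≤ 1 := by
  induction n using Nat.twoStepInduction with
  | zero => simp [legendrePoly]
  | one => simp [legendrePoly]
  | more n ih _ =>
    have h := legendrePoly_eval_zero_recurrence n
    have h2 : ((n : ℝ) + 2) ^ 2 * (legendrePoly (n + 2)).eval 0 ^ 2 =
        ((n : ℝ) + 1) ^ 2 * (legendrePoly n).eval 0 ^ 2 := by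
      rw [← mul_pow, ← mul_pow, h]; ring
    have hp : (0 : ℝ) < ((n : ℝ) + 2) ^ 2 := by positivity
    refine le_of_mul_le_mul_left ?_ hp
    push_cast
    calc ((n : ℝ) + 2) ^ 2 * ((legendrePoly (n + 2)).eval 0 ^ 2 * ((n : ℝ) + 2 + 1))
        = ((legendrePoly n).eval 0 ^ 2 * ((n : ℝ) + 1)) * (((n : ℝ) + 1) * (n + 3)) := by
          linear_combination ((n : ℝ) + 3) * h2
      _ ≤ 1 * (((n : ℝ) + 1) * (n + 3)) := by gcongr
      _ ≤ _ := by nlinarith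

theorem eval_le_eval_zero_of_mul_derivative_nonpos (S : ℝ[X])
    (hS : ∀ t : ℝ, t * (derivative S).eval t ≤ 0) (t : ℝ) : S.eval t ≤ S.eval 0 := by
  rcases le_total 0 t with ht | ht
  · refine antitoneOn_of_deriv_nonpos (convex_Ici (0 : ℝ)) S.continuous.continuousOn
      S.differentiable.differentiableOn (fun x hx => ?_) (Set.self_mem_Ici) ht ht
    rw [interior_Ici] at hx
    rw [Polynomial.deriv]
    exact nonpos_of_mul_nonpos_right (hS x) hx
  · refine monotoneOn_of_deriv_nonneg (convex_Iic (0 : ℝ)) S.continuous.continuousOn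
      S.differentiable.differentiableOn (fun x hx => ?_) ht (Set.self_mem_Iic) ht
    rw [interior_Iic] at hx
    rw [Polynomial.deriv]
    by_contra hn
    exact (hS x).not_gt (mul_pos_of_neg_of_neg hx (not_le.mp hn))

/-- The Sonin-type bound for the first primitive of a Legendre polynomial. -/
theorem legendrePrimitive_sq_le (n : ℕ) {t : ℝ} (ht : t ∈ Set.Icc (-1 : ℝ) 1) :
    (derivative^[n] (rodriguesBase (n + 1))).eval t ^ 2 ≤ 2 / ((n : ℝ) + 1) ^ 3 := by
  set Q := derivative^[n] (rodriguesBase (n + 1)) with hQ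
  have hQ' : derivative Q = legendrePoly (n + 1) := by
    rw [legendrePoly_eq_iterate_derivative, Function.iterate_succ_apply']
  set N : ℝ := ((n : ℝ) + 1) * (n + 2) with hN
  have hN0 : 0 < N := by positivity
  have hode := sq_sub_one_mul_derivative_legendrePoly n
  rw [← hQ, ← hN] at hode
  set P := legendrePoly (n + 1) with hP
  -- Since `Q' = P` and `(X^2 - 1) P' = N Q`, the cross terms cancel and the derivative is `-2 t
  -- P^2`.
  have key := eval_le_eval_zero_of_mul_derivative_nonpos (C N * Q ^ 2 + (1 - X ^ 2) * P ^ 2)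
    (fun s => by
      have h := congrArg (eval s) hode
      have e : (derivative (C N * Q ^ 2 + (1 - X ^ 2) * P ^ 2)).eval s =
          -2 * s * P.eval s ^ 2 := by
        simp [derivative_pow, hQ'] at h ⊢
        linear_combination (-2 * P.eval s) * h
      rw [e]
      nlinarith [mul_nonneg (sq_nonneg s) (sq_nonneg (P.eval s))]) t
  simp at key
  have h1 : 0 ≤ (1 - t ^ 2) * P.eval t ^ 2 :=
    mul_nonneg (by nlinarith [ht.1, ht.2]) (sq_nonneg _)
  have h2 := legendrePrimitive_eval_zero n
  rw [← hQ] at h2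
  have h3 := legendrePoly_eval_zero_sq_le n
  have h4 := legendrePoly_eval_zero_sq_le (n + 1)
  rw [← hP] at h4
  push_cast at h4
  set a : ℝ := (n : ℝ) + 1 with ha
  have ha1 : (n : ℝ) + 2 = a + 1 := by rw [ha]; ring
  have ha0 : 1 ≤ a := by rw [ha]; simp
  rw [ha1] at h2 hN
  have h5 : Q.eval t ^ 2 * N ≤ 2 / (a + 1) := by
    have e1 : N * Q.eval 0 ^ 2 ≤ 1 / (a + 1) := by
      rw [le_div_iff₀ (by positivity)]
      calc N * Q.eval 0 ^ 2 * (a + 1) = a * ((a + 1) * Q.eval 0) ^ 2 := by rw [hN]; ring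
        _ = (legendrePoly n).eval 0 ^ 2 * a := by rw [h2]; ring
        _ ≤ 1 := h3
    have e2 : P.eval 0 ^ 2 ≤ 1 / (a + 1) := by
      rw [le_div_iff₀ (by positivity)]; exact h4
    have : (2 : ℝ) / (a + 1) = 1 / (a + 1) + 1 / (a + 1) := by ring
    rw [this]
    linarith
  rw [le_div_iff₀ (by positivity)]
  rw [le_div_iff₀ (by positivity)] at h5
  refine le_trans ?_ h5
  rw [hN, mul_assoc]
  refine mul_le_mul_of_nonneg_left ?_ (sq_nonneg _)
  nlinarith

/-- The `m`-th primitive of the Legendre polynomial of degree `n` is `O(n ^ (-m - 1/2))`, uniformly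
on `[-1, 1]`. -/
theorem exists_iterate_derivative_rodriguesBase_bound (m : ℕ) :
    ∃ C : ℝ, 0 ≤ C ∧ ∀ j : ℕ, ∀ t ∈ Set.Icc (-1 : ℝ) 1,
      |(derivative^[j] (rodriguesBase (j + (m + 1)))).eval t| *
        ((j : ℝ) + m + 1) ^ ((m : ℝ) + 3 / 2) ≤ C := by
  induction m with
  | zero =>
    refine ⟨√2, Real.sqrt_nonneg _, fun j t ht => Real.le_sqrt_of_sq_le ?_⟩
    have h := legendrePrimitive_sq_le j ht
    have hj : (0 : ℝ) < (j : ℝ) + 1 := by positivity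
    rw [le_div_iff₀ (by positivity)] at h
    rw [mul_pow, sq_abs]
    simp only [Nat.cast_zero, add_zero, zero_add]
    rw [← Real.rpow_natCast (_ ^ (3 / 2 : ℝ)), ← Real.rpow_mul hj.le]
    norm_num at h ⊢
    exact h
  | succ m ih =>
    obtain ⟨C, hC, h⟩ := ih
    -- The recurrence relates degree parameters `x + 2` and `x` to `x + 1`; passing from `x` to `x +
    -- 1 ≤ 2x` costs `2^(m+3/2)`.
    refine ⟨(1 + 2 ^ ((m : ℝ) + 3 / 2)) * C, by positivity, fun j t ht => ?_⟩
    have hA := h (j + 2) t ht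
    have hB := h j t ht
    have hrec := congrArg (fun p => |eval t p|)
      (iterate_derivative_rodriguesBase_recurrence j (j + (m + 1)))
    rw [show j + 2 + (m + 1) = j + (m + 1) + 2 by ring] at hA
    rw [show j + (m + 1 + 1) = j + (m + 1) + 1 by ring]
    simp only [eval_mul, eval_C, eval_sub, abs_mul] at hrec
    set A := eval t (derivative^[j + 2] (rodriguesBase (j + (m + 1) + 2)))
    set B := eval t (derivative^[j] (rodriguesBase (j + (m + 1))))
    set Q := eval t (derivative^[j] (rodriguesBase (j + (m + 1) + 1)))
    push_cast at hrec hA ⊢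
    set x : ℝ := (j : ℝ) + m + 1 with hx
    have hx1 : 1 ≤ x := by rw [hx]; have : (0 : ℝ) ≤ (j : ℝ) + m := by positivity
                           linarith
    set a : ℝ := (m : ℝ) + 3 / 2 with ha
    have ha0 : 0 ≤ a := by positivity
    rw [show (j : ℝ) + 2 + m + 1 = x + 2 by rw [hx]; ring] at hA
    rw [show (j : ℝ) + (m + 1) = x by rw [hx]; ring] at hrec ⊢
    rw [show (m : ℝ) + 1 + 3 / 2 = a + 1 by rw [ha]; ring, Real.rpow_add_one (by positivity)]
    rw [abs_of_nonneg (by positivity : (0 : ℝ) ≤ 2 * x + 3)] at hrec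
    have e1 : (x + 1) ^ a ≤ (x + 2) ^ a := Real.rpow_le_rpow (by positivity) (by linarith) ha0
    have e2 : (x + 1) ^ a ≤ 2 ^ a * x ^ a := by
      rw [← Real.mul_rpow (by norm_num) (by positivity)]
      exact Real.rpow_le_rpow (by positivity) (by linarith) ha0
    calc |Q| * ((x + 1) ^ a * (x + 1)) ≤ |Q| * ((x + 1) ^ a * (2 * x + 3)) := by
          gcongr _ * (_ * ?_); linarith
      _ = |A - B| * (x + 1) ^ a := by rw [← hrec]; ring
      _ ≤ (|A| + |B|) * (x + 1) ^ a := by gcongr; exact abs_sub _ _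
      _ = |A| * (x + 1) ^ a + |B| * (x + 1) ^ a := by ring
      _ ≤ |A| * (x + 2) ^ a + |B| * (2 ^ a * x ^ a) := by gcongr
      _ = |A| * (x + 2) ^ a + 2 ^ a * (|B| * x ^ a) := by ring
      _ ≤ C + 2 ^ a * C := by gcongr
      _ = _ := by ring

end Polynomials

/-! ### Extending the weak identity to polynomials vanishing at the endpoints. -/

section WeakDerivative

open MeasureTheory Filter Topology

theorem Polynomial.iteratedDeriv_eval (p : Polynomial ℝ) (j : ℕ) :
    iteratedDeriv j (fun x => p.eval x) = fun x => (derivative^[j] p).eval x := by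
  induction j with
  | zero => simp
  | succ j ih =>
    ext x
    rw [iteratedDeriv_succ, ih, Function.iterate_succ_apply', Polynomial.deriv]

theorem Polynomial.contDiff_eval (p : Polynomial ℝ) : ContDiff ℝ ∞ fun x => p.eval x := by
  simpa [Polynomial.coe_aeval_eq_eval] using p.contDiff_aeval (𝕜 := ℝ) ∞

theorem exists_abs_iteratedDeriv_mul_le {ι : Type*} {s : Set ℝ} {m : ℕ} {f g : ι → ℝ → ℝ}
    (hf : ∀ k, ContDiff ℝ ∞ (f k)) (hg : ∀ k, ContDiff ℝ ∞ (g k))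
    (hfb : ∃ C, ∀ k, ∀ j ≤ m, ∀ t ∈ s, |iteratedDeriv j (f k) t| ≤ C)
    (hgb : ∃ C, ∀ k, ∀ j ≤ m, ∀ t ∈ s, |iteratedDeriv j (g k) t| ≤ C) :
    ∃ C, ∀ k, ∀ j ≤ m, ∀ t ∈ s, |iteratedDeriv j (fun x => f k x * g k x) t| ≤ C := by
  obtain ⟨A, hA⟩ := hfb
  obtain ⟨B, hB⟩ := hgb
  refine ⟨2 ^ m * (|A| * |B|), fun k j hj t ht => ?_⟩
  rw [iteratedDeriv_fun_mul ((hf k).contDiffAt.of_le (by exact_mod_cast le_top))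
    ((hg k).contDiffAt.of_le (by exact_mod_cast le_top))]
  calc _ ≤ ∑ i ∈ Finset.range (j + 1), (j.choose i : ℝ) * (|A| * |B|) := by
        refine (Finset.abs_sum_le_sum_abs _ _).trans (Finset.sum_le_sum fun i hi => ?_)
        have hi' : i ≤ j := Nat.lt_succ_iff.mp (Finset.mem_range.mp hi)
        rw [abs_mul, abs_mul, mul_assoc, Nat.abs_cast]
        exact mul_le_mul_of_nonneg_left (mul_le_mul
          ((hA k i (hi'.trans hj) t ht).trans (le_abs_self _))
          ((hB k _ ((Nat.sub_le _ _).trans hj) t ht).trans (le_abs_self _))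
          (abs_nonneg _) (abs_nonneg _)) (Nat.cast_nonneg _)
    _ = 2 ^ j * (|A| * |B|) := by
        rw [← Finset.sum_mul]
        congr 1
        exact_mod_cast Nat.sum_range_choose j
    _ ≤ _ := by gcongr; norm_num

/-- A smooth modification of `x ^ m` that vanishes for `x ≤ 1`. -/
noncomputable def cutPow (m : ℕ) (x : ℝ) : ℝ :=
  x ^ m * Real.smoothTransition (x - 1)

theorem contDiff_cutPow (m : ℕ) : ContDiff ℝ ∞ (cutPow m) :=
  (contDiff_id.pow m).mul (Real.smoothTransition.contDiff.comp (contDiff_id.sub contDiff_const))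

theorem cutPow_of_le_one (m : ℕ) {x : ℝ} (hx : x ≤ 1) : cutPow m x = 0 := by
  rw [cutPow, Real.smoothTransition.zero_of_nonpos (by linarith), mul_zero]

theorem cutPow_of_two_le (m : ℕ) {x : ℝ} (hx : 2 ≤ x) : cutPow m x = x ^ m := by
  rw [cutPow, Real.smoothTransition.one_of_one_le (by linarith), mul_one]

/-- The derivative of order exactly `m` is `0` on the left, `m!` on the right, and continuous on the
compact part between. -/
theorem exists_abs_iteratedDeriv_cutPow_le (m : ℕ) :
    ∃ C, ∀ x, |iteratedDeriv m (cutPow m) x| ≤ C := by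
  have hc : Continuous (iteratedDeriv m (cutPow m)) :=
    (contDiff_cutPow m).continuous_iteratedDeriv m (by exact_mod_cast le_top)
  obtain ⟨C, hC⟩ := (isCompact_Icc (a := (0 : ℝ)) (b := 3)).exists_bound_of_continuousOn
    hc.continuousOn
  refine ⟨max C (max 0 m.factorial), fun x => ?_⟩
  rcases lt_or_ge x 0 with h0 | h0
  · have h : cutPow m =ᶠ[𝓝 x] fun _ => 0 := by
      filter_upwards [Iio_mem_nhds h0] with y hy
      exact cutPow_of_le_one m (by linarith [Set.mem_Iio.mp hy])
    rw [h.iteratedDeriv_eq, iteratedDeriv_fun_const_zero]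
    simp
  rcases le_or_gt x 3 with h3 | h3
  · exact (hC x ⟨h0, h3⟩).trans (le_max_left _ _)
  · have h : cutPow m =ᶠ[𝓝 x] fun y => y ^ m := by
      filter_upwards [Ioi_mem_nhds h3] with y hy
      exact cutPow_of_two_le m (by linarith [Set.mem_Ioi.mp hy])
    rw [h.iteratedDeriv_eq, iteratedDeriv_pow]
    simp [Nat.descFactorial_self]

/-- The rescaled cutoff power `c ^ (-m) * cutPow m (c * x)`, equal to `x ^ m` for `c * x ≥ 2`. -/
noncomputable def scaledCutPow (m : ℕ) (c x : ℝ) : ℝ :=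
  (c ^ m)⁻¹ * cutPow m (c * x)

theorem contDiff_scaledCutPow (m : ℕ) (c : ℝ) : ContDiff ℝ ∞ (scaledCutPow m c) :=
  contDiff_const.mul ((contDiff_cutPow m).comp (contDiff_const.mul contDiff_id))

theorem scaledCutPow_of_mul_le_one (m : ℕ) {c x : ℝ} (hx : c * x ≤ 1) :
    scaledCutPow m c x = 0 := by
  rw [scaledCutPow, cutPow_of_le_one m hx, mul_zero]

theorem scaledCutPow_of_two_le_mul (m : ℕ) {c x : ℝ} (hc : c ≠ 0) (hx : 2 ≤ c * x) :
    scaledCutPow m c x = x ^ m := by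
  rw [scaledCutPow, cutPow_of_two_le m hx, mul_pow, inv_mul_cancel_left₀ (pow_ne_zero m hc)]

theorem iteratedDeriv_scaledCutPow_zero (m j : ℕ) (c : ℝ) :
    iteratedDeriv j (scaledCutPow m c) 0 = 0 := by
  have h : scaledCutPow m c =ᶠ[𝓝 0] fun _ => 0 := by
    have : Tendsto (fun x => c * x) (𝓝 0) (𝓝 (c * 0)) := (continuous_const_mul c).tendsto 0
    rw [mul_zero] at this
    filter_upwards [this.eventually_lt_const one_pos] with y hy
    exact scaledCutPow_of_mul_le_one m hy.le
  rw [h.iteratedDeriv_eq, iteratedDeriv_fun_const_zero]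

/-- The scaling leaves the size of the `m`-th derivative unchanged. Lower orders vanish at `0`, so
each integration over `[0, 2]` costs at most a factor `2`, uniformly in `k`. -/
theorem exists_abs_iteratedDeriv_scaledCutPow_le (m : ℕ) :
    ∃ C, ∀ k : ℕ, ∀ j ≤ m, ∀ x ∈ Set.Icc (0 : ℝ) 2,
      |iteratedDeriv j (scaledCutPow m ((k : ℝ) + 1)) x| ≤ C := by
  obtain ⟨C, hC⟩ := exists_abs_iteratedDeriv_cutPow_le m
  have hC0 : 0 ≤ C := (abs_nonneg _).trans (hC 0)
  have main : ∀ i ≤ m, ∀ k : ℕ, ∀ x ∈ Set.Icc (0 : ℝ) 2,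
      |iteratedDeriv (m - i) (scaledCutPow m ((k : ℝ) + 1)) x| ≤ C * 2 ^ i := by
    intro i
    induction i with
    | zero =>
      intro _ k x _
      have hk : ((k : ℝ) + 1) ^ m ≠ 0 := by positivity
      have e : iteratedDeriv m (scaledCutPow m ((k : ℝ) + 1)) x =
          iteratedDeriv m (cutPow m) (((k : ℝ) + 1) * x) := by
        unfold scaledCutPow
        rw [iteratedDeriv_const_mul_field, iteratedDeriv_comp_const_mul
          ((contDiff_cutPow m).of_le (by exact_mod_cast le_top)), inv_mul_cancel_left₀ hk]
      rw [Nat.sub_zero, e, pow_zero, mul_one]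
      exact hC _
    | succ i ih =>
      intro hi k x hx
      have hd : Differentiable ℝ (iteratedDeriv (m - (i + 1)) (scaledCutPow m ((k : ℝ) + 1))) :=
        (contDiff_scaledCutPow m _).differentiable_iteratedDeriv _
          (WithTop.coe_lt_coe.mpr (ENat.natCast_lt_top _))
      have h := (convex_Icc (0 : ℝ) 2).norm_image_sub_le_of_norm_deriv_le
        (f := iteratedDeriv (m - (i + 1)) (scaledCutPow m ((k : ℝ) + 1))) (C := C * 2 ^ i)
        (fun y _ => hd y)
        (fun y hy => by
          rw [← iteratedDeriv_succ, show m - (i + 1) + 1 = m - i by omega]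
          exact ih (by omega) k y hy)
        (Set.left_mem_Icc.mpr zero_le_two) hx
      rw [iteratedDeriv_scaledCutPow_zero, sub_zero, sub_zero, Real.norm_eq_abs,
        Real.norm_eq_abs, abs_of_nonneg hx.1] at h
      calc _ ≤ C * 2 ^ i * x := h
        _ ≤ C * 2 ^ i * 2 := by gcongr; exact hx.2
        _ = _ := by ring
  refine ⟨C * 2 ^ m, fun k j hj x hx => ?_⟩
  have h := main (m - j) (Nat.sub_le _ _) k x hx
  rw [Nat.sub_sub_self hj] at h
  refine h.trans ?_
  gcongr
  · norm_num
  · exact Nat.sub_le _ _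

theorem exists_abs_iteratedDeriv_le_of_isCompact {s : Set ℝ} (hs : IsCompact s) {f : ℝ → ℝ}
    (hf : ContDiff ℝ ∞ f) (m : ℕ) :
    ∃ C, ∀ j ≤ m, ∀ t ∈ s, |iteratedDeriv j f t| ≤ C := by
  have h : ∀ j, ∃ C, ∀ t ∈ s, |iteratedDeriv j f t| ≤ C := fun j =>
    hs.exists_bound_of_continuousOn
      (hf.continuous_iteratedDeriv j (by exact_mod_cast le_top)).continuousOn
  choose C hC using h
  refine ⟨∑ i ∈ Finset.range (m + 1), |C i|, fun j hj t ht => ?_⟩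
  exact ((hC j t ht).trans (le_abs_self _)).trans
    (Finset.single_le_sum (f := fun i => |C i|) (fun i _ => abs_nonneg _)
      (Finset.mem_range.mpr (Nat.lt_succ_of_le hj)))

theorem tendsto_integral_smul_of_eventually_eq {𝕜 : Type*} [RCLike 𝕜] {f : ℝ → 𝕜}
    (hf : IntegrableOn f (Set.Icc (-1 : ℝ) 1)) {ψ : ℕ → ℝ → ℝ} {ψ' : ℝ → ℝ} {C : ℝ}
    (hψ : ∀ k, Continuous (ψ k)) (hC : ∀ k, ∀ t ∈ Set.Icc (-1 : ℝ) 1, |ψ k t| ≤ C)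
    (hlim : ∀ t ∈ Set.Ioo (-1 : ℝ) 1, ∀ᶠ k in atTop, ψ k t = ψ' t) :
    Tendsto (fun k => ∫ t in (-1 : ℝ)..1, ψ k t • f t) atTop
      (𝓝 (∫ t in (-1 : ℝ)..1, ψ' t • f t)) := by
  have hI : Set.uIoc (-1 : ℝ) 1 = Set.Ioc (-1) 1 := Set.uIoc_of_le (by norm_num)
  have hfI : IntegrableOn f (Set.Ioc (-1 : ℝ) 1) := hf.mono_set Set.Ioc_subset_Icc_self
  refine intervalIntegral.tendsto_integral_filter_of_dominated_convergence
    (fun t => C * ‖f t‖) (Eventually.of_forall fun k => ?_)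
    (Eventually.of_forall fun k => Eventually.of_forall fun t ht => ?_) ?_ ?_
  · rw [hI]
    exact (hψ k).aestronglyMeasurable.smul hfI.aestronglyMeasurable
  · rw [hI] at ht
    rw [norm_smul]
    gcongr
    exact hC k t (Set.Ioc_subset_Icc_self ht)
  · rw [intervalIntegrable_iff, hI]
    exact hfI.norm.const_mul C
  -- The integral runs over `Ioc (-1) 1`, so the endpoint `1` is discarded as a null set.
  · filter_upwards [compl_mem_ae_iff.mpr (measure_singleton (1 : ℝ))] with t ht1 ht
    rw [hI] at ht
    refine tendsto_const_nhds.congr' ?_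
    filter_upwards [hlim t ⟨ht.1, lt_of_le_of_ne ht.2 ht1⟩] with k hk
    rw [hk]

/-- Smooth compactly supported approximation of `R t * (1 - t ^ 2) ^ m` on `(-1, 1)`. -/
noncomputable def cutoffApprox (m : ℕ) (R : Polynomial ℝ) (k : ℕ) (t : ℝ) : ℝ :=
  R.eval t * (scaledCutPow m ((k : ℝ) + 1) (1 + t) * scaledCutPow m ((k : ℝ) + 1) (1 - t))

theorem contDiff_cutoffApprox (m : ℕ) (R : Polynomial ℝ) (k : ℕ) :
    ContDiff ℝ ∞ (cutoffApprox m R k) :=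
  R.contDiff_eval.mul (((contDiff_scaledCutPow m _).comp (contDiff_const.add contDiff_id)).mul
    ((contDiff_scaledCutPow m _).comp (contDiff_const.sub contDiff_id)))

theorem tsupport_cutoffApprox_subset (m : ℕ) (R : Polynomial ℝ) (k : ℕ) :
    tsupport (cutoffApprox m R k) ⊆
      Set.Icc (-1 + ((k : ℝ) + 1)⁻¹) (1 - ((k : ℝ) + 1)⁻¹) := by
  refine closure_minimal (fun t ht => ?_) isClosed_Icc
  have hk : (0 : ℝ) < (k : ℝ) + 1 := by positivity
  rw [Function.mem_support, cutoffApprox] at ht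
  have h1 := left_ne_zero_of_mul (right_ne_zero_of_mul ht)
  have h2 := right_ne_zero_of_mul (right_ne_zero_of_mul ht)
  have h1' : 1 < ((k : ℝ) + 1) * (1 + t) := by
    by_contra h
    exact h1 (scaledCutPow_of_mul_le_one m (not_lt.mp h))
  have h2' : 1 < ((k : ℝ) + 1) * (1 - t) := by
    by_contra h
    exact h2 (scaledCutPow_of_mul_le_one m (not_lt.mp h))
  rw [← div_lt_iff₀' hk, one_div] at h1' h2'
  constructor <;> linarith

theorem exists_abs_iteratedDeriv_cutoffApprox_le (m : ℕ) (R : Polynomial ℝ) :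
    ∃ C, ∀ k, ∀ j ≤ m, ∀ t ∈ Set.Icc (-1 : ℝ) 1,
      |iteratedDeriv j (cutoffApprox m R k) t| ≤ C := by
  obtain ⟨A, hA⟩ := exists_abs_iteratedDeriv_le_of_isCompact
    (isCompact_Icc (a := (-1 : ℝ)) (b := 1)) R.contDiff_eval m
  obtain ⟨B, hB⟩ := exists_abs_iteratedDeriv_scaledCutPow_le m
  have hs : ∀ k : ℕ, ContDiff ℝ ∞ fun t => scaledCutPow m ((k : ℝ) + 1) (1 + t) := fun k =>
    (contDiff_scaledCutPow m _).comp (contDiff_const.add contDiff_id)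
  have hs' : ∀ k : ℕ, ContDiff ℝ ∞ fun t => scaledCutPow m ((k : ℝ) + 1) (1 - t) := fun k =>
    (contDiff_scaledCutPow m _).comp (contDiff_const.sub contDiff_id)
  refine exists_abs_iteratedDeriv_mul_le (fun _ => R.contDiff_eval) (fun k => (hs k).mul (hs' k))
    ⟨A, fun _ => hA⟩ (exists_abs_iteratedDeriv_mul_le hs hs' ⟨B, fun k j hj t ht => ?_⟩
      ⟨B, fun k j hj t ht => ?_⟩)
  · rw [iteratedDeriv_comp_const_add]
    exact hB k j hj _ ⟨by linarith [ht.1], by linarith [ht.2]⟩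
  · rw [iteratedDeriv_comp_const_sub]
    simp only [smul_eq_mul, abs_mul, abs_pow, abs_neg, abs_one, one_pow, one_mul]
    exact hB k j hj _ ⟨by linarith [ht.2], by linarith [ht.1]⟩

/-- Equality on a neighbourhood, not just at `t`, transfers to all derivatives. -/
theorem eventually_cutoffApprox_eventuallyEq (m : ℕ) (R : Polynomial ℝ) {t : ℝ}
    (ht : t ∈ Set.Ioo (-1 : ℝ) 1) :
    ∀ᶠ k in atTop, cutoffApprox m R k =ᶠ[𝓝 t]
      fun x => (R * (1 - Polynomial.X ^ 2) ^ m).eval x := by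
  have key : ∀ a : ℝ, 0 < a → ∀ᶠ k : ℕ in atTop, 2 < ((k : ℝ) + 1) * a := fun a ha =>
    ((tendsto_natCast_atTop_atTop.atTop_add tendsto_const_nhds).atTop_mul_const
      ha).eventually_gt_atTop 2
  filter_upwards [key (1 + t) (by linarith [ht.1]), key (1 - t) (by linarith [ht.2])]
    with k h1 h2
  have hk : (k : ℝ) + 1 ≠ 0 := by positivity
  have c1 : Continuous fun x : ℝ => ((k : ℝ) + 1) * (1 + x) := by fun_prop
  have c2 : Continuous fun x : ℝ => ((k : ℝ) + 1) * (1 - x) := by fun_prop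
  filter_upwards [c1.continuousAt.eventually_const_lt h1, c2.continuousAt.eventually_const_lt h2]
    with x hx1 hx2
  rw [cutoffApprox, scaledCutPow_of_two_le_mul m hk hx1.le,
    scaledCutPow_of_two_le_mul m hk hx2.le, ← mul_pow]
  simp
  ring_nf
  simp

/-- Integration by parts against a polynomial vanishing to order `m` at the endpoints. -/
theorem IsWeakIteratedDeriv.integral_iterate_derivative_smul {𝕜 : Type*} [RCLike 𝕜] {m : ℕ}
    {f g : ℝ → 𝕜} (h : IsWeakIteratedDeriv m f g)
    (hf : IntegrableOn f (Set.Icc (-1 : ℝ) 1)) (hg : IntegrableOn g (Set.Icc (-1 : ℝ) 1))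
    {Q : Polynomial ℝ} (hQ : (Polynomial.X ^ 2 - 1) ^ m ∣ Q) :
    ∫ t in (-1 : ℝ)..1, (Polynomial.derivative^[m] Q).eval t • f t =
      (-1 : ℝ) ^ m • ∫ t in (-1 : ℝ)..1, Q.eval t • g t := by
  obtain ⟨R, hR⟩ : (1 - Polynomial.X ^ 2) ^ m ∣ Q := by
    rwa [← neg_sub, neg_pow, ((isUnit_one.neg).pow m).mul_left_dvd]
  rw [mul_comm] at hR
  subst hR
  obtain ⟨C, hC⟩ := exists_abs_iteratedDeriv_cutoffApprox_le m R
  have hsupp : ∀ k : ℕ, HasCompactSupport (cutoffApprox m R k) := fun k =>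
    isCompact_Icc.of_isClosed_subset (isClosed_tsupport _) (tsupport_cutoffApprox_subset m R k)
  have hsub : ∀ k : ℕ, tsupport (cutoffApprox m R k) ⊆ Set.Ioo (-1 : ℝ) 1 := fun k =>
    (tsupport_cutoffApprox_subset m R k).trans fun t ht => by
      have : (0 : ℝ) < ((k : ℝ) + 1)⁻¹ := by positivity
      exact ⟨by linarith [ht.1], by linarith [ht.2]⟩
  have e := fun k => h _ (contDiff_cutoffApprox m R k) (hsupp k) (hsub k)
  -- Dominated convergence on both sides of `e`; the uniform bound on derivatives up to order `m`
  -- supplies the majorants.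
  have l1 := tendsto_integral_smul_of_eventually_eq hf
    (ψ := fun k => iteratedDeriv m (cutoffApprox m R k))
    (ψ' := fun t => (Polynomial.derivative^[m] (R * (1 - Polynomial.X ^ 2) ^ m)).eval t)
    (fun k => (contDiff_cutoffApprox m R k).continuous_iteratedDeriv m
      (by exact_mod_cast le_top))
    (fun k => hC k m le_rfl) (fun t ht => by
      filter_upwards [eventually_cutoffApprox_eventuallyEq m R ht] with k hk
      rw [hk.iteratedDeriv_eq, Polynomial.iteratedDeriv_eval])
  have l2 := tendsto_integral_smul_of_eventually_eq hg
    (ψ := cutoffApprox m R)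
    (ψ' := fun t => (R * (1 - Polynomial.X ^ 2) ^ m).eval t)
    (fun k => (contDiff_cutoffApprox m R k).continuous)
    (fun k t ht => by simpa using hC k 0 (Nat.zero_le m) t ht) (fun t ht => by
      filter_upwards [eventually_cutoffApprox_eventuallyEq m R ht] with k hk
      exact hk.self_of_nhds)
  exact tendsto_nhds_unique l1 ((l2.const_smul ((-1 : ℝ) ^ m)).congr fun k => (e k).symm)

end WeakDerivative

/-! ### Decay of the Legendre coefficients. -/

theorem sq_sub_one_pow_dvd_iterate_derivative_rodriguesBase (j m : ℕ) :
    (Polynomial.X ^ 2 - 1) ^ m ∣ Polynomial.derivative^[j] (rodriguesBase (j + m)) := by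
  rw [rodriguesBase, Polynomial.iterate_derivative_C_mul]
  have h := Polynomial.pow_sub_dvd_iterate_derivative_pow
    (Polynomial.X ^ 2 - 1 : Polynomial ℝ) (j + m) j
  rw [Nat.add_sub_cancel_left] at h
  exact h.mul_left _

theorem norm_legendreCoeff_le {𝕜 : Type*} [RCLike 𝕜] {m j : ℕ} {f g : ℝ → 𝕜} {B : ℝ}
    (hf : MeasureTheory.IntegrableOn f (Set.Icc (-1 : ℝ) 1))
    (hg : MeasureTheory.IntegrableOn g (Set.Icc (-1 : ℝ) 1))
    (h : IsWeakIteratedDeriv m f g)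
    (hB : ∀ t ∈ Set.Icc (-1 : ℝ) 1,
      |(Polynomial.derivative^[j] (rodriguesBase (j + m))).eval t| ≤ B) :
    ‖legendreCoeff f (j + m)‖ ≤
      (2 * ((j + m : ℕ) : ℝ) + 1) / 2 * (B * ∫ t in (-1 : ℝ)..1, ‖g t‖) := by
  have hP : legendrePoly (j + m) =
      Polynomial.derivative^[m] (Polynomial.derivative^[j] (rodriguesBase (j + m))) := by
    rw [legendrePoly_eq_iterate_derivative, ← Function.iterate_add_apply, add_comm m j]
  rw [legendreCoeff, hP, h.integral_iterate_derivative_smul hf hg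
    (sq_sub_one_pow_dvd_iterate_derivative_rodriguesBase j m), norm_smul, norm_smul,
    Real.norm_of_nonneg (by positivity)]
  simp only [norm_pow, norm_neg, norm_one, one_pow, one_mul]
  gcongr
  rw [← intervalIntegral.integral_const_mul]
  refine intervalIntegral.norm_integral_le_of_norm_le (by norm_num)
    (Filter.Eventually.of_forall fun t ht => ?_) ?_
  · rw [norm_smul]
    gcongr
    exact hB t (Set.Ioc_subset_Icc_self ht)
  · rw [intervalIntegrable_iff, Set.uIoc_of_le (by norm_num)]
    exact (hg.mono_set Set.Ioc_subset_Icc_self).norm.const_mul B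

theorem mainTheorem5 {𝕜 : Type*} [RCLike 𝕜] (m : ℕ) (hm : 1 ≤ m) (f : ℝ → 𝕜)
    (hf : MeasureTheory.IntegrableOn f (Set.Icc (-1 : ℝ) 1))
    (hfm : ∃ g : ℝ → 𝕜, MeasureTheory.IntegrableOn g (Set.Icc (-1 : ℝ) 1) ∧
      IsWeakIteratedDeriv m f g) :
    ∃ C : ℝ, ∀ n : ℕ, 1 ≤ n →
      ‖legendreCoeff f n‖ ≤ C / (n : ℝ) ^ ((m : ℝ) - 1 / 2) := by
  obtain ⟨g, hg, hfg⟩ := hfm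
  obtain ⟨m, rfl⟩ : ∃ k, m = k + 1 := ⟨m - 1, by omega⟩
  obtain ⟨B, hB0, hB⟩ := exists_iterate_derivative_rodriguesBase_bound m
  set I := ∫ t in (-1 : ℝ)..1, ‖g t‖ with hI
  have hI0 : 0 ≤ I :=
    intervalIntegral.integral_nonneg (by norm_num) fun t _ => norm_nonneg _
  set w : ℕ → ℝ := fun n => ‖legendreCoeff f n‖ * (n : ℝ) ^ (((m + 1 : ℕ) : ℝ) - 1 / 2) with hw
  have hw0 : ∀ n, 0 ≤ w n := fun n => by positivity
  -- The sum absorbs the finitely many degrees below the order of differentiation, where `n = j + (m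
  -- + 1)` is impossible; `3 / 2` bounds `(2n+1)/(2n)` for `n ≥ 1`.
  refine ⟨∑ i ∈ Finset.range (m + 1), w i + 3 / 2 * (B * I), fun n hn => ?_⟩
  have hn0 : (0 : ℝ) < n := by exact_mod_cast hn
  rw [le_div_iff₀ (by positivity)]
  change w n ≤ _
  rcases lt_or_ge n (m + 1) with hlt | hge
  · have h1 := Finset.single_le_sum (f := w) (fun i _ => hw0 i) (Finset.mem_range.mpr hlt)
    have h2 : 0 ≤ 3 / 2 * (B * I) := by positivity
    linarith
  · obtain ⟨j, rfl⟩ : ∃ j, n = j + (m + 1) := ⟨n - (m + 1), by omega⟩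
    have hS : 0 ≤ ∑ i ∈ Finset.range (m + 1), w i := Finset.sum_nonneg fun i _ => hw0 i
    set x : ℝ := ((j + (m + 1) : ℕ) : ℝ) with hx
    have hx1 : 1 ≤ x := by rw [hx]; exact_mod_cast hn
    have hbound : ∀ t ∈ Set.Icc (-1 : ℝ) 1,
        |(Polynomial.derivative^[j] (rodriguesBase (j + (m + 1)))).eval t| ≤
          B / x ^ ((m : ℝ) + 3 / 2) := fun t ht => by
      rw [le_div_iff₀ (by positivity)]
      have h := hB j t ht
      rwa [show (j : ℝ) + m + 1 = x by rw [hx]; push_cast; ring] at h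
    have h := norm_legendreCoeff_le hf hg hfg hbound
    rw [← hx, ← hI] at h
    have hpow : x ^ ((m : ℝ) + 3 / 2) = x ^ (((m + 1 : ℕ) : ℝ) - 1 / 2) * x := by
      rw [← Real.rpow_add_one (by positivity)]
      congr 1
      push_cast
      ring
    set y := x ^ (((m + 1 : ℕ) : ℝ) - 1 / 2) with hy
    have hy0 : 0 < y := by positivity
    rw [hpow] at h
    calc w (j + (m + 1)) ≤ (2 * x + 1) / 2 * (B / (y * x) * I) * y := by
          change _ * y ≤ _
          gcongr
      _ = (2 * x + 1) / (2 * x) * (B * I) := by field_simp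
      _ ≤ 3 / 2 * (B * I) := by
          gcongr ?_ * _
          rw [div_le_div_iff₀ (by positivity) (by norm_num)]
          linarith
      _ ≤ _ := by linarith
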